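/- **Setting.** Let $\mathbb T\subseteq\mathbb R$ be a time scale (a closed set) with $0\in\mathbb T$, forward jump $\sigma$ and graininess $\mu(t)=\sigma(t)-t$; $J_{\mathbb T}=J\cap\mathbb T$. Let $\tau_1,\tau_2>0$, $\tau=\max\{\tau_1,\tau_2\}$, $\beta\ge 0$, and assume that $t-\tau_1,\ t-\tau_2,\ t-\beta,\ t+\beta\in\mathbb T$ for every $t\in[0,\infty)_{\mathbb T}$. Let $A=\mathrm{diag}(a_1,\dots,a_n)$ with all $a_i>0$, let $P,Q,R,K\in\mathbb R^{n\times n}$, $I\in\mathbb R^n$, $F:\mathbb R^n\to\mathbb R^n$. The drive system is $$x^\Delta(t)=-Ax(t)+PF(x(t))+QF(x(t-\tau_1))+R\int_{t-\tau_2}^tF(x(s))\,\Delta s+I,\quad t\in[0,\infty)_{\mathbb T},\qquad x=\phi\ \text{on }[-\tau,0]_{\mathbb T},$$ continued by $x(s)=\phi(-\tau)$ on $[-\tau-\beta,-\tau]_{\mathbb T}$, and the response system is $$y^\Delta(t)=-Ay(t)+PF(y(t))+QF(y(t-\tau_1))+R\int_{t-\tau_2}^tF(y(s))\,\Delta s+I-K\bigl(y(t)-x(t-\beta)\bigr),\quad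 t\in[0,\infty)_{\mathbb T},\qquad y=\psi\ \text{on }[-\tau,0]_{\mathbb T},$$ with $\phi,\psi$ rd-continuous on $[-\tau,0]_{\mathbb T}$. Delta derivatives are taken in the time scale $[0,\infty)_{\mathbb T}$ (so one-sided at $0$), and the Cauchy delta integrals are assumed to exist. For $p\in\{1,2,\infty\}$, $\|\cdot\|_p$ is the vector $p$-norm and the induced matrix norm, $\Lambda_p(W)=\lim_{s\to0^+}(\|\mathrm{Id}+sW\|_p-1)/s$, and $M_p(W,\mathbb T)$ is the supremum of the numbers $(\|\mathrm{Id}+\mu(t)W\|_p-1)/\mu(t)$ over $t\in\mathbb T$ with $\mu(t)>0$, together with the number $\Lambda_p(W)$ if $\mu(t)=0$ for some $t\in\mathbb T$. For $\nu>0$ let $(\ominus\nu)(t)=-\nu/(1+\mu(t)\nu)$, and let $e_{\ominus\nu}(t,s)$ be the time scale exponential function of $\ominus\nu$. **Theorem.** Let $p\in\{1,2,\infty\}$ and $L_F>0$ be such that $\|F(v)-F(w)\|_p\le L_F\|v-w\|_p$ for all $v,w\in\mathbb R^n$. Suppose that for some nonsingular $Z\in\mathbb R^{n\times n}$ the constants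 $$\mathcal M_3=-\bigl(M_p(-Z(A+K)Z^{-1},\mathbb T)+\|Z\|_p\|Z^{-1}\|_p\|P\|_pL_F\bigr),\qquad \mathcal M_4=\|Z\|_p\|Z^{-1}\|_pL_F\bigl(\|Q\|_p+\tau\|R\|_p\bigr)$$ satisfy $\mathcal M_3-\mathcal M_4>0$ and $-\mathcal M_3\in\mathcal R^+$, i.e. $1-\mu(t)\mathcal M_3>0$ for all $t\in\mathbb T$. Then the drive and response systems are exponentially lag synchronized: there is $\nu>0$ such that for all rd-continuous initial functions $\phi,\psi$ and all solutions $x$ and $y$ of the two systems there is $C>0$ with $$\|y(t)-x(t-\beta)\|_p\le C\,e_{\ominus\nu}(t,0)\qquad\text{for all }t\in[0,\infty)_{\mathbb T}.$$ -/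

import Mathlib

open Set Filter Topology
open scoped ENNReal Matrix

noncomputable section

namespace TimeScale

/-- Forward jump operator `σ(t) = inf {s ∈ T : s > t}`, with `σ(t) = t` if `t` is the maximum. -/
def sigma (T : Set ℝ) (t : ℝ) : ℝ :=
  open Classical in if (∃ s ∈ T, t < s) then sInf {s ∈ T | t < s} else t

/-- Backward jump operator `ρ(t) = sup {s ∈ T : s < t}`, with `ρ(t) = t` if `t` is the minimum. -/
def rho (T : Set ℝ) (t : ℝ) : ℝ :=
  open Classical in if (∃ s ∈ T, s < t) then sSup {s ∈ T | s < t} else t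

/-- Graininess `μ(t) = σ(t) - t`. -/
def graininess (T : Set ℝ) (t : ℝ) : ℝ := sigma T t - t

def RightDense (T : Set ℝ) (t : ℝ) : Prop := (∃ s ∈ T, t < s) ∧ sigma T t = t

def LeftDense (T : Set ℝ) (t : ℝ) : Prop := (∃ s ∈ T, s < t) ∧ rho T t = t

/-- `f` is rd-continuous on the time scale `T`: continuous (relative to `T`) at right-dense points,
with finite left limits at left-dense points. Finite right limits at right-dense points follow from
the continuity there. -/
def RdContinuous {E : Type*} [TopologicalSpace E] (T : Set ℝ) (f : ℝ → E) : Prop :=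
  ∀ t ∈ T, (RightDense T t → ContinuousWithinAt f T t) ∧
    (LeftDense T t → ∃ l, Tendsto f (𝓝[T ∩ Iio t] t) (𝓝 l))

/-- `f'` is a delta derivative of `f` at `t` with respect to the time scale `T`. -/
def HasDeltaDerivAt {E : Type*} [NormedAddCommGroup E] [NormedSpace ℝ E]
    (T : Set ℝ) (f : ℝ → E) (f' : E) (t : ℝ) : Prop :=
  ∀ ε > 0, ∃ δ > 0, ∀ s ∈ T, |s - t| < δ →
    ‖(f (sigma T t) - f s) - (sigma T t - s) • f'‖ ≤ ε * |sigma T t - s|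

/-- `G` is an antiderivative of `f` on the time scale interval between `a` and `b`. As `f` need only
be given on that interval, the derivative is taken in the time scale interval itself, and at its
right end point (where a delta derivative would depend on later points) `G` is just continuous. -/
def IsDeltaAntideriv {E : Type*} [NormedAddCommGroup E] [NormedSpace ℝ E]
    (T : Set ℝ) (f : ℝ → E) (a b : ℝ) (G : ℝ → E) : Prop :=
  ContinuousOn G (T ∩ uIcc a b) ∧
    ∀ t ∈ T ∩ uIcc a b, t < max a b → HasDeltaDerivAt (T ∩ uIcc a b) G (f t) t

def DeltaIntegrable {E : Type*} [NormedAddCommGroup E] [NormedSpace ℝ E]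
    (T : Set ℝ) (f : ℝ → E) (a b : ℝ) : Prop :=
  ∃ G : ℝ → E, IsDeltaAntideriv T f a b G

/-- Cauchy delta integral `∫_a^b f(s) Δs = G(b) - G(a)`, for `a, b ∈ T` and any antiderivative `G`
of `f` (and `0` if there is none). -/
def deltaIntegral {E : Type*} [NormedAddCommGroup E] [NormedSpace ℝ E]
    (T : Set ℝ) (f : ℝ → E) (a b : ℝ) : E :=
  open Classical in
  if h : DeltaIntegrable T f a b then h.choose b - h.choose a else 0

def PositivelyRegressive (T : Set ℝ) (q : ℝ → ℝ) : Prop :=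
  RdContinuous T q ∧ ∀ t ∈ T, 0 < 1 + graininess T t * q t

/-- `(⊖q)(t) = -q(t) / (1 + μ(t) q(t))`. -/
def ominus (T : Set ℝ) (q : ℝ → ℝ) (t : ℝ) : ℝ := -(q t / (1 + graininess T t * q t))

/-- The cylinder transformation `ζ_{μ(t)}(q(t))`. -/
def cylinder (T : Set ℝ) (q : ℝ → ℝ) (t : ℝ) : ℝ :=
  open Classical in
  if graininess T t = 0 then q t
  else Real.log (1 + graininess T t * q t) / graininess T t

/-- The time scale exponential `e_q(t, s)` of a positively regressive function `q`. -/
def expTS (T : Set ℝ) (q : ℝ → ℝ) (t s : ℝ) : ℝ :=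
  Real.exp (deltaIntegral T (cylinder T q) s t)

end TimeScale

namespace LagSync

open TimeScale

/-- The `p`-norm of a vector. -/
def vecNorm {n : ℕ} (p : ℝ≥0∞) [Fact (1 ≤ p)] (v : Fin n → ℝ) : ℝ := ‖WithLp.toLp p v‖

/-- The matrix norm induced by the vector `p`-norm. -/
def matNorm {n : ℕ} (p : ℝ≥0∞) [Fact (1 ≤ p)] (W : Matrix (Fin n) (Fin n) ℝ) : ℝ :=
  ‖(Matrix.toLpLin p p W).toContinuousLinearMap‖

/-- Generalized matrix measure `(‖Id + h W‖_p - 1) / h`. -/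
def genMatrixMeasure {n : ℕ} (p : ℝ≥0∞) [Fact (1 ≤ p)] (W : Matrix (Fin n) (Fin n) ℝ) (h : ℝ) : ℝ :=
  (matNorm p (1 + h • W) - 1) / h

/-- Classical matrix measure `Λ_p(W) = lim_{s → 0+} (‖Id + s W‖_p - 1) / s`. -/
def classicalMatrixMeasure {n : ℕ} (p : ℝ≥0∞) [Fact (1 ≤ p)] (W : Matrix (Fin n) (Fin n) ℝ) : ℝ :=
  limUnder (𝓝[>] (0 : ℝ)) (fun s => genMatrixMeasure p W s)

/-- Unified matrix measure `M_p(W, T)` on the time scale `T`; the maximum over `t ∈ T` is read as a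
supremum (the set is bounded above by `‖W‖_p` as soon as `n ≥ 1`). -/
def unifiedMatrixMeasure {n : ℕ} (p : ℝ≥0∞) [Fact (1 ≤ p)] (W : Matrix (Fin n) (Fin n) ℝ)
    (T : Set ℝ) : ℝ :=
  open Classical in
  if ∀ t ∈ T, 0 < graininess T t then
    sSup {r | ∃ t ∈ T, r = genMatrixMeasure p W (graininess T t)}
  else
    sSup (insert (classicalMatrixMeasure p W)
      {r | ∃ t ∈ T, 0 < graininess T t ∧ r = genMatrixMeasure p W (graininess T t)})

/-- The data of a network `x^Δ = -A x + P F(x) + Q F(x(· - τ₁)) + R ∫_{·-τ₂}^· F(x) Δs + I`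
with `A = diag(a)`. -/
structure Network (n : ℕ) where
  a : Fin n → ℝ
  P : Matrix (Fin n) (Fin n) ℝ
  Q : Matrix (Fin n) (Fin n) ℝ
  R : Matrix (Fin n) (Fin n) ℝ
  F : (Fin n → ℝ) → (Fin n → ℝ)
  I : Fin n → ℝ
  τ₁ : ℝ
  τ₂ : ℝ

namespace Network

variable {n : ℕ}

def A (N : Network n) : Matrix (Fin n) (Fin n) ℝ := Matrix.diagonal N.a

def τ (N : Network n) : ℝ := max N.τ₁ N.τ₂

/-- The right-hand side of the network equation along `x` at time `t`. -/
def rhs (N : Network n) (T : Set ℝ) (x : ℝ → Fin n → ℝ) (t : ℝ) : Fin n → ℝ :=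
  -(N.A *ᵥ x t) + N.P *ᵥ N.F (x t) + N.Q *ᵥ N.F (x (t - N.τ₁))
    + N.R *ᵥ deltaIntegral T (fun s => N.F (x s)) (t - N.τ₂) t + N.I

/-- `x` solves the network equation with the additional input `u` on the time scale `[0, ∞)_T`
(so that the derivative at `0` is one-sided), with initial function `φ` on `[-τ, 0]_T`. -/
def IsSolution (N : Network n) (T : Set ℝ) (u : ℝ → Fin n → ℝ) (φ x : ℝ → Fin n → ℝ) : Prop :=
  (∀ s ∈ T, -N.τ ≤ s → s ≤ 0 → x s = φ s) ∧
  ∀ t ∈ T, 0 ≤ t →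
    DeltaIntegrable T (fun s => N.F (x s)) (t - N.τ₂) t ∧
    HasDeltaDerivAt (T ∩ Ici 0) x (N.rhs T x t + u t) t

/-- The drive system, its state being continued by the constant `φ(-τ)` on `[-τ-β, -τ]_T`. -/
def IsDriveSolution (N : Network n) (T : Set ℝ) (β : ℝ) (φ x : ℝ → Fin n → ℝ) : Prop :=
  N.IsSolution T (fun _ => 0) φ x ∧
  ∀ s ∈ T, -N.τ - β ≤ s → s ≤ -N.τ → x s = φ (-N.τ)

/-- The response system with the control `u(t) = -K (y(t) - x(t - β))`. -/
def IsResponseSolution (N : Network n) (T : Set ℝ) (K : Matrix (Fin n) (Fin n) ℝ) (β : ℝ)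
    (x ψ y : ℝ → Fin n → ℝ) : Prop :=
  N.IsSolution T (fun t => -(K *ᵥ (y t - x (t - β)))) ψ y

/-- Exponential lag synchronization (with initial time `0`) of the drive and response systems under
the control with gain `K`. The rate `ν` is common to all initial functions. -/
def ExpLagSynchronized (N : Network n) (p : ℝ≥0∞) [Fact (1 ≤ p)] (T : Set ℝ)
    (K : Matrix (Fin n) (Fin n) ℝ) (β : ℝ) : Prop :=
  ∃ ν : ℝ, 0 < ν ∧ ∀ φ ψ x y : ℝ → Fin n → ℝ,
    RdContinuous (T ∩ Icc (-N.τ) 0) φ → RdContinuous (T ∩ Icc (-N.τ) 0) ψ →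
    N.IsDriveSolution T β φ x → N.IsResponseSolution T K β x ψ y →
    ∃ C : ℝ, 0 < C ∧ ∀ t ∈ T, 0 ≤ t →
      vecNorm p (y t - x (t - β)) ≤ C * expTS T (ominus T (fun _ => ν)) t 0

/-- `M₃ = -(M_p(-Z(A+K)Z⁻¹, T) + ‖Z‖ ‖Z⁻¹‖ ‖P‖ L_F)`. -/
def M₃ (N : Network n) (p : ℝ≥0∞) [Fact (1 ≤ p)] (T : Set ℝ)
    (K Z : Matrix (Fin n) (Fin n) ℝ) (L : ℝ) : ℝ :=
  -(unifiedMatrixMeasure p (-(Z * (N.A + K) * Z⁻¹)) T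
    + matNorm p Z * matNorm p Z⁻¹ * matNorm p N.P * L)

/-- `M₄ = ‖Z‖ ‖Z⁻¹‖ L_F (‖Q‖ + τ ‖R‖)`. -/
def M₄ (N : Network n) (p : ℝ≥0∞) [Fact (1 ≤ p)] (Z : Matrix (Fin n) (Fin n) ℝ) (L : ℝ) : ℝ :=
  matNorm p Z * matNorm p Z⁻¹ * L * (matNorm p N.Q + N.τ * matNorm p N.R)

end Network

end LagSync

end

/-! For `t > β` the error `e(t) = y(t) - x(t-β)` satisfies `e^Δ = -(A+K) e + k`, where `k` collects
the differences of the `P`, `Q` and `R` terms. Put `w = Z e`, so that the linear part becomes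
`-Z(A+K)Z⁻¹`. As long as `‖w‖` has stayed below `C exp(-νs)`, the Lipschitz bound and a delay of at
most `τ` bound the input `Z k` by a multiple of `‖w(t)‖` plus `M₄ exp(ντ) C exp(-νt)`
(`vecNorm_errorInput_le`). The rate is any `ν > 0` with `ν + M₄ exp(ντ) < M₃`.

The Halanay inequality `norm_le_mul_exp_of_hasDeltaDerivAt` propagates the bound by induction on the
time scale: at a scattered point one exact step suffices, and at a dense point the strict gap
absorbs the first-order errors. The matrix measure controls `‖1 + hB‖` in both cases. The induction
starts at some `t₀ ≥ β + τ`, from which every delayed error is evaluated at a nonnegative time;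
before `t₀` compactness gives a constant. Finally `exp(-νt) ≤ e_{⊖ν}(t,0)`, so an ordinary
exponential serves as comparison function throughout. -/

namespace TimeScale

/-! ### Forward jumps and induction on a time scale. -/

section Sigma

variable {S S' : Set ℝ} {s t : ℝ}

theorem isGLB_sigma (h : ∃ s ∈ S, t < s) : IsGLB (S ∩ Ioi t) (sigma S t) := by
  rw [sigma, if_pos h]
  obtain ⟨r, hr, htr⟩ := h
  exact isGLB_csInf ⟨r, hr, htr⟩ ⟨t, fun _ hx => hx.2.le⟩

theorem sigma_eq_self_of_not (h : ¬ ∃ s ∈ S, t < s) : sigma S t = t := if_neg h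

theorem le_sigma : t ≤ sigma S t := by
  by_cases h : ∃ s ∈ S, t < s
  · exact (isGLB_sigma h).2 fun _ hx => hx.2.le
  · rw [sigma_eq_self_of_not h]

theorem sigma_le (hs : s ∈ S) (hts : t < s) : sigma S t ≤ s :=
  (isGLB_sigma ⟨s, hs, hts⟩).1 ⟨hs, hts⟩

theorem exists_gt_of_lt_sigma (h : t < sigma S t) : ∃ s ∈ S, t < s := by
  by_contra hc
  rw [sigma_eq_self_of_not hc] at h
  exact lt_irrefl _ h

/-- The forward jump sees only points strictly above `t`. Hence the two sets need to be translates
of each other only there, which allows time scales truncated on the left. -/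
theorem sigma_eq_sigma_sub_add {β : ℝ} (h : ∀ s, t < s → (s ∈ S ↔ s - β ∈ S')) :
    sigma S t = sigma S' (t - β) + β := by
  by_cases hS : ∃ s ∈ S, t < s
  · have hS' : ∃ s ∈ S', t - β < s := by
      obtain ⟨r, hr, htr⟩ := hS
      exact ⟨r - β, (h r htr).1 hr, by linarith⟩
    refine (isGLB_sigma hS).unique ⟨fun s hs => ?_, fun b hb => ?_⟩
    · have := sigma_le ((h s hs.2).1 hs.1) (show t - β < s - β by linarith [hs.2.out])
      linarith
    · have : b - β ≤ sigma S' (t - β) := by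
        refine (isGLB_sigma hS').2 fun s hs => ?_
        have hts : t < s + β := by linarith [hs.2.out]
        have := hb ⟨(h (s + β) hts).2 (by simpa using hs.1), hts⟩
        linarith
      linarith
  · have hS' : ¬ ∃ s ∈ S', t - β < s := by
      rintro ⟨r, hr, htr⟩
      have hts : t < r + β := by linarith
      exact hS ⟨r + β, (h _ hts).2 (by simpa using hr), hts⟩
    rw [sigma_eq_self_of_not hS, sigma_eq_self_of_not hS']
    ring

theorem sigma_congr (h : ∀ s, t < s → (s ∈ S ↔ s ∈ S')) : sigma S t = sigma S' t := by
  have := sigma_eq_sigma_sub_add (S := S) (S' := S') (t := t) (β := 0) (by simpa using h)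
  simpa using this

theorem graininess_nonneg : 0 ≤ graininess S t := sub_nonneg.2 le_sigma

/-- The induction principle on a closed time scale. -/
theorem induction_on (hS : IsClosed S) {a : ℝ} (ha : a ∈ S) {p : ℝ → Prop} (h0 : p a)
    (hscat : ∀ t ∈ S, a ≤ t → t < sigma S t → (∀ s ∈ S, a ≤ s → s ≤ t → p s) → p (sigma S t))
    (hdense : ∀ t ∈ S, a ≤ t → RightDense S t → (∀ s ∈ S, a ≤ s → s ≤ t → p s) →
      ∀ᶠ s in 𝓝[S ∩ Ioi t] t, p s)
    (hleft : ∀ t ∈ S, a < t → t ∈ closure (S ∩ Ico a t) → (∀ s ∈ S, a ≤ s → s < t → p s) → p t) :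
    ∀ t ∈ S, a ≤ t → p t := by
  by_contra! hc
  obtain ⟨b, hb, hab, hpb⟩ := hc
  set B : Set ℝ := {t | t ∈ S ∧ a ≤ t ∧ ¬ p t} with hB
  have hne : B.Nonempty := ⟨b, hb, hab, hpb⟩
  have hbdd : BddBelow B := ⟨a, fun x hx => hx.2.1⟩
  set m := sInf B with hm
  have hglb : IsGLB B m := isGLB_csInf hne hbdd
  have hmS : m ∈ S :=
    hS.closure_subset_iff.2 (fun x (hx : x ∈ B) => hx.1) (hglb.mem_closure hne)
  have ham : a ≤ m := hglb.2 fun x hx => hx.2.1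
  have hlt : ∀ s ∈ S, a ≤ s → s < m → p s := by
    intro s hs has hsm
    by_contra hps
    exact absurd (hglb.1 ⟨hs, has, hps⟩) (not_le.2 hsm)
  have hpm : p m := by
    rcases ham.eq_or_lt with h | h
    · rwa [← h]
    by_cases hcl : m ∈ closure (S ∩ Ico a m)
    · exact hleft m hmS h hcl hlt
    -- Here `m` is left-scattered: it is the forward jump of the last earlier point `r`.
    · have hne' : (S ∩ Ico a m).Nonempty := ⟨a, ha, le_rfl, h⟩
      have hlub := isLUB_csSup hne' ⟨m, fun x hx => hx.2.2.le⟩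
      set r := sSup (S ∩ Ico a m) with hr
      have hrm : r ≤ m := hlub.2 fun x hx => hx.2.2.le
      have hrcl := hlub.mem_closure hne'
      have hrm' : r < m := lt_of_le_of_ne hrm fun h => hcl (h ▸ hrcl)
      have hrS : r ∈ S := hS.closure_subset_iff.2 inter_subset_left hrcl
      have har : a ≤ r := hlub.1 ⟨ha, le_rfl, h⟩
      have hσ : sigma S r = m := by
        refine le_antisymm (sigma_le hmS hrm') ((isGLB_sigma ⟨m, hmS, hrm'⟩).2 fun x hx => ?_)
        by_contra hxm
        exact absurd (hlub.1 ⟨hx.1, har.trans hx.2.out.le, not_le.1 hxm⟩) (not_le.2 hx.2.out)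
      have := hscat r hrS har (by rw [hσ]; exact hrm') fun s hs has hsr =>
        hlt s hs has (hsr.trans_lt hrm')
      rwa [hσ] at this
  have hmB : m ∉ B := fun h => h.2.2 hpm
  have hle : ∀ s ∈ S, a ≤ s → s ≤ m → p s := fun s hs has hsm =>
    hsm.eq_or_lt.elim (fun h => h ▸ hpm) (hlt s hs has)
  obtain ⟨c, hcB⟩ := hne
  have hmc : ∀ x ∈ B, m < x := fun x hx =>
    lt_of_le_of_ne (hglb.1 hx) fun h => hmB (h ▸ hx)
  -- Failures accumulate at `m` from the right, so `m` is right-dense.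
  have hσ : sigma S m = m := by
    refine le_antisymm (hglb.2 fun x hx => sigma_le hx.1 (hmc x hx)) le_sigma
  have hev := hdense m hmS ham ⟨⟨c, hcB.1, hmc c hcB⟩, hσ⟩ hle
  have hfr : ∃ᶠ s in 𝓝[B] m, s ∈ B :=
    have := mem_closure_iff_nhdsWithin_neBot.1 (hglb.mem_closure ⟨c, hcB⟩)
    Eventually.frequently (self_mem_nhdsWithin (s := B) (a := m))
  have hsub : B ⊆ S ∩ Ioi m := fun x hx => ⟨hx.1, hmc x hx⟩
  have hev' : ∀ᶠ s in 𝓝[B] m, p s := hev.filter_mono (nhdsWithin_mono m hsub)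
  obtain ⟨s, hs, hps⟩ := (hfr.and_eventually hev').exists
  exact hs.2.2 hps

end Sigma

/-! ### Delta derivatives and the mean value inequality. -/

section Deriv

variable {E : Type*} [NormedAddCommGroup E] [NormedSpace ℝ E]
variable {E' : Type*} [NormedAddCommGroup E'] [NormedSpace ℝ E']
variable {S S' : Set ℝ} {f g : ℝ → E} {f' g' : E} {t : ℝ}

theorem HasDeltaDerivAt.clm_comp (h : HasDeltaDerivAt S f f' t) (l : E →L[ℝ] E') :
    HasDeltaDerivAt S (fun s => l (f s)) (l f') t := by
  intro ε hε
  obtain ⟨δ, hδ, H⟩ := h (ε / (‖l‖ + 1)) (by positivity)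
  refine ⟨δ, hδ, fun s hs hst => ?_⟩
  rw [← map_sub, ← map_smul, ← map_sub]
  calc _ ≤ ‖l‖ * (ε / (‖l‖ + 1) * |sigma S t - s|) := l.le_opNorm_of_le (H s hs hst)
    _ ≤ (‖l‖ + 1) * (ε / (‖l‖ + 1) * |sigma S t - s|) := by gcongr; linarith
    _ = ε * |sigma S t - s| := by field_simp

theorem HasDeltaDerivAt.sub (hf : HasDeltaDerivAt S f f' t) (hg : HasDeltaDerivAt S g g' t) :
    HasDeltaDerivAt S (fun s => f s - g s) (f' - g') t := by
  intro ε hε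
  obtain ⟨δ, hδ, H⟩ := hf (ε / 2) (by positivity)
  obtain ⟨δ', hδ', H'⟩ := hg (ε / 2) (by positivity)
  refine ⟨min δ δ', lt_min hδ hδ', fun s hs hst => ?_⟩
  have h1 := H s hs (hst.trans_le (min_le_left _ _))
  have h2 := H' s hs (hst.trans_le (min_le_right _ _))
  calc _ = ‖((f (sigma S t) - f s) - (sigma S t - s) • f')
          - ((g (sigma S t) - g s) - (sigma S t - s) • g')‖ := by
        congr 1; module
    _ ≤ _ := norm_sub_le _ _
    _ ≤ ε * |sigma S t - s| := by linarith

theorem HasDeltaDerivAt.comp_sub_const {β : ℝ} (h : HasDeltaDerivAt S' f f' (t - β))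
    (hσ : sigma S t = sigma S' (t - β) + β) (hS : ∀ᶠ s in 𝓝 t, s ∈ S → s - β ∈ S') :
    HasDeltaDerivAt S (fun s => f (s - β)) f' t := by
  intro ε hε
  obtain ⟨δ, hδ, H⟩ := h ε hε
  obtain ⟨δ', hδ', H'⟩ := Metric.eventually_nhds_iff.1 hS
  refine ⟨min δ δ', lt_min hδ hδ', fun s hs hst => ?_⟩
  have h1 := H (s - β) (H' (by rw [Real.dist_eq]; exact hst.trans_le (min_le_right _ _)) hs)
    (by rw [sub_sub_sub_cancel_right]; exact hst.trans_le (min_le_left _ _))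
  have e1 : sigma S t - β = sigma S' (t - β) := by rw [hσ]; ring
  have e2 : sigma S t - s = sigma S' (t - β) - (s - β) := by rw [hσ]; ring
  simp only [e1, e2]
  exact h1

/-- Taking `s = t` in the definition leaves a fixed quantity below every `ε`. This exact formula is
the step at scattered points. -/
theorem HasDeltaDerivAt.apply_sigma (h : HasDeltaDerivAt S f f' t) (ht : t ∈ S) :
    f (sigma S t) = f t + graininess S t • f' := by
  have : ‖(f (sigma S t) - f t) - (sigma S t - t) • f'‖ ≤ 0 := by
    refine le_of_forall_pos_le_add fun ε hε => ?_
    have hpos : 0 < |sigma S t - t| + 1 := by positivity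
    obtain ⟨δ, hδ, H⟩ := h (ε / (|sigma S t - t| + 1)) (by positivity)
    refine (H t ht (by simpa using hδ)).trans ?_
    rw [zero_add, div_mul_eq_mul_div, div_le_iff₀ hpos]
    gcongr
    linarith
  have h0 := norm_le_zero_iff.1 this
  rw [sub_eq_zero, sub_eq_iff_eq_add] at h0
  rw [h0, graininess, add_comm]

theorem HasDeltaDerivAt.continuousWithinAt (h : HasDeltaDerivAt S f f' t) (ht : t ∈ S) :
    ContinuousWithinAt f S t := by
  rw [Metric.continuousWithinAt_iff]
  intro ε hε
  have hσ := h.apply_sigma ht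
  set μ := graininess S t with hμ
  have hμ0 : 0 ≤ μ := graininess_nonneg
  set c := ε / (2 * (μ + 1)) with hc
  have hcpos : 0 < c := by positivity
  obtain ⟨δ, hδ, H⟩ := h c hcpos
  refine ⟨min (min δ 1) (ε / (2 * (‖f'‖ + 1))), by positivity, fun s hs hst => ?_⟩
  rw [Real.dist_eq] at hst
  have hst1 : |s - t| < δ := hst.trans_le ((min_le_left _ _).trans (min_le_left _ _))
  have hst2 : |s - t| < 1 := hst.trans_le ((min_le_left _ _).trans (min_le_right _ _))
  have hst3 : |s - t| < ε / (2 * (‖f'‖ + 1)) := hst.trans_le (min_le_right _ _)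
  have h1 := H s hs hst1
  have e : sigma S t = t + μ := by rw [hμ, graininess]; ring
  have h2 : |sigma S t - s| ≤ μ + 1 := by
    rw [e, abs_le]; rw [abs_lt] at hst2; constructor <;> linarith [hst2.1, hst2.2]
  have h3 : ‖(f (sigma S t) - f s) - (sigma S t - s) • f'‖ ≤ ε / 2 := by
    refine h1.trans ((mul_le_mul_of_nonneg_left h2 hcpos.le).trans_eq ?_)
    rw [hc]; field_simp
  have h4 : ‖(s - t) • f'‖ < ε / 2 := by
    rw [norm_smul, Real.norm_eq_abs]
    rw [lt_div_iff₀ (by positivity)] at hst3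
    nlinarith [abs_nonneg (s - t), norm_nonneg f', hst3, hε]
  have e3 : f s - f t = -((f (sigma S t) - f s) - (sigma S t - s) • f') + (s - t) • f' := by
    rw [hσ, e]
    module
  rw [dist_eq_norm, e3]
  refine (norm_add_le _ _).trans_lt ?_
  rw [norm_neg]
  linarith

theorem HasDeltaDerivAt.eventually_norm_sub_le (h : HasDeltaDerivAt S f f' t)
    (hσ : sigma S t = t) {ε : ℝ} (hε : 0 < ε) :
    ∀ᶠ s in 𝓝[S ∩ Ioi t] t, ‖f s - (f t + (s - t) • f')‖ ≤ ε * (s - t) := by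
  obtain ⟨δ, hδ, H⟩ := h ε hε
  have : ∀ᶠ s in 𝓝[S ∩ Ioi t] t, |s - t| < δ := by
    refine (Metric.eventually_nhds_iff.2 ⟨δ, hδ, fun s hs => ?_⟩).filter_mono nhdsWithin_le_nhds
    rwa [Real.dist_eq] at hs
  filter_upwards [this, self_mem_nhdsWithin] with s hs hsS
  have := H s hsS.1 hs
  rw [hσ, abs_sub_comm, abs_of_pos (sub_pos.2 hsS.2.out)] at this
  refine le_trans (le_of_eq ?_) this
  rw [← norm_neg]
  congr 1
  module

/-- Comparison of a function with a line, from bounds on its increments to the right. -/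
theorem le_add_mul_of_right_increments {S : Set ℝ} (hS : IsClosed S) {a b B : ℝ} (ha : a ∈ S)
    (hb : b ∈ S) (hab : a ≤ b) {u : ℝ → ℝ} (hu : ContinuousOn u S)
    (hscat : ∀ t ∈ S, a ≤ t → t < sigma S t → u (sigma S t) ≤ u t + B * (sigma S t - t))
    (hdense : ∀ t ∈ S, a ≤ t → RightDense S t → ∀ ε > 0,
      ∀ᶠ s in 𝓝[S ∩ Ioi t] t, u s ≤ u t + (B + ε) * (s - t)) :
    u b ≤ u a + B * (b - a) := by
  -- The slope is enlarged by `ε` to make the right-dense step possible; `ε → 0` at the end.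
  have key : ∀ ε > 0, u b ≤ u a + (B + ε) * (b - a) := by
    intro ε hε
    refine induction_on hS ha (p := fun t => u t ≤ u a + (B + ε) * (t - a)) (by simp)
      ?_ ?_ ?_ b hb hab
    · intro t ht hat htσ hp
      have h1 := hscat t ht hat htσ
      have h2 := hp t ht hat le_rfl
      nlinarith
    · intro t ht hat hd hp
      filter_upwards [hdense t ht hat hd ε hε] with s hs
      have h2 := hp t ht hat le_rfl
      nlinarith
    · intro t ht hat hcl hp
      have hne : (𝓝[S ∩ Ico a t] t).NeBot := mem_closure_iff_nhdsWithin_neBot.1 hcl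
      refine le_of_tendsto_of_tendsto (b := 𝓝[S ∩ Ico a t] t) (f := u) (g := fun t => u a + (B + ε) * (t - a))
        ((hu t ht).mono_left (nhdsWithin_mono _ inter_subset_left))
        ((Continuous.tendsto (by fun_prop) t).mono_left nhdsWithin_le_nhds) ?_
      filter_upwards [self_mem_nhdsWithin] with s hs
      exact hp s hs.1 hs.2.1 hs.2.2
  have hlim : Tendsto (fun ε => u a + (B + ε) * (b - a)) (𝓝[>] 0) (𝓝 (u a + (B + 0) * (b - a))) :=
    (Continuous.tendsto (by fun_prop) 0).mono_left nhdsWithin_le_nhds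
  rw [add_zero] at hlim
  exact ge_of_tendsto hlim (eventually_nhdsWithin_of_forall fun ε hε => key ε hε)

/-- The mean value inequality on a closed time scale. -/
theorem norm_sub_le_of_hasDeltaDerivAt {S : Set ℝ} (hS : IsClosed S) {a b B : ℝ} (ha : a ∈ S)
    (hb : b ∈ S) (hab : a ≤ b) {f f' : ℝ → E} (hf : ContinuousOn f S)
    (hf' : ∀ t ∈ S, a ≤ t → (∃ s ∈ S, t < s) → HasDeltaDerivAt S f (f' t) t)
    (hB : ∀ t ∈ S, a ≤ t → (∃ s ∈ S, t < s) → ‖f' t‖ ≤ B) :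
    ‖f b - f a‖ ≤ B * (b - a) := by
  have := le_add_mul_of_right_increments hS ha hb hab (B := B) (u := fun t => ‖f t - f a‖)
    (hf.sub continuousOn_const).norm ?_ ?_
  · simpa using this
  · intro t ht hat htσ
    have hex := exists_gt_of_lt_sigma htσ
    have h1 := (hf' t ht hat hex).apply_sigma ht
    have e : f (sigma S t) - f a = (f t - f a) + graininess S t • f' t := by rw [h1]; abel
    simp only [e]
    refine (norm_add_le _ _).trans ?_
    rw [norm_smul, Real.norm_eq_abs, abs_of_nonneg graininess_nonneg, mul_comm]
    exact add_le_add_right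
      (mul_le_mul_of_nonneg_right (hB t ht hat hex) (graininess_nonneg (S := S) (t := t))) _
  · intro t ht hat hd ε hε
    filter_upwards [(hf' t ht hat hd.1).eventually_norm_sub_le hd.2 hε, self_mem_nhdsWithin]
      with s hs hsS
    have hst : 0 ≤ s - t := (sub_pos.2 hsS.2.out).le
    have e : f s - f a = (f s - (f t + (s - t) • f' t)) + ((f t - f a) + (s - t) • f' t) := by abel
    rw [e]
    refine (norm_add_le _ _).trans ?_
    have h2 := norm_add_le (f t - f a) ((s - t) • f' t)
    rw [norm_smul, Real.norm_eq_abs, abs_of_nonneg hst] at h2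
    nlinarith [mul_le_mul_of_nonneg_left (hB t ht hat hd.1) hst]

end Deriv

/-! ### Comparison of the ordinary and the time scale exponential. -/

section Exp

variable {T : Set ℝ}

/-- At a scattered point the value is `-log(1 + μν)/μ`, and `log(1 + μν) ≤ μν`. -/
theorem neg_le_cylinder_ominus {ν t : ℝ} (hν : 0 ≤ ν) :
    -ν ≤ cylinder T (ominus T fun _ => ν) t := by
  have hμ : 0 ≤ graininess T t := graininess_nonneg
  unfold cylinder ominus
  split_ifs with h
  · simp [h]
  · have hμ' : 0 < graininess T t := lt_of_le_of_ne hμ (Ne.symm h)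
    have hpos : 0 < 1 + graininess T t * ν := by positivity
    have e : 1 + graininess T t * -(ν / (1 + graininess T t * ν))
        = (1 + graininess T t * ν)⁻¹ := by field_simp; ring
    rw [e, Real.log_inv, le_div_iff₀ hμ']
    linarith [Real.log_le_sub_one_of_pos hpos]

theorem exp_neg_mul_le_expTS (hT : IsClosed T) {ν a t : ℝ} (hν : 0 ≤ ν) (ha : a ∈ T) (ht : t ∈ T)
    (hat : a ≤ t) : Real.exp (-(ν * (t - a))) ≤ expTS T (ominus T fun _ => ν) t a := by
  unfold expTS deltaIntegral
  rw [Real.exp_le_exp]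
  split_ifs with h
  · have hG := h.choose_spec
    set G := h.choose
    obtain ⟨hc, hd⟩ := hG
    rw [uIcc_of_le hat] at hc hd
    rw [max_eq_right hat] at hd
    have hS : IsClosed (T ∩ Icc a t) := hT.inter isClosed_Icc
    have := le_add_mul_of_right_increments hS (a := a) (b := t) (B := ν) ⟨ha, le_rfl, hat⟩
      ⟨ht, hat, le_rfl⟩ hat (u := fun s => -G s) hc.neg ?_ ?_
    · linarith
    · intro s hs _ hσ
      obtain ⟨r, hr, hsr⟩ := exists_gt_of_lt_sigma hσ
      have h1 := (hd s hs (hsr.trans_le hr.2.2)).apply_sigma hs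
      have h2 := mul_le_mul_of_nonneg_left (neg_le_cylinder_ominus (T := T) (t := s) hν)
        (graininess_nonneg (S := T ∩ Icc a t) (t := s))
      rw [h1, smul_eq_mul]
      unfold graininess at *
      linarith
    · intro s hs _ hσ ε hε
      obtain ⟨r, hr, hsr⟩ := hσ.1
      filter_upwards [(hd s hs (hsr.trans_le hr.2.2)).eventually_norm_sub_le hσ.2 hε,
        self_mem_nhdsWithin] with q hq hqS
      have hsq : 0 ≤ q - s := (sub_pos.2 hqS.2.out).le
      have h2 := mul_le_mul_of_nonneg_left (neg_le_cylinder_ominus (T := T) (t := s) hν) hsq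
      rw [Real.norm_eq_abs, smul_eq_mul] at hq
      linarith [(abs_le.1 hq).1]
  -- Without an antiderivative the integral is `0` by convention, and `-(ν(t-a)) ≤ 0`.
  · nlinarith

end Exp

/-! ### Comparison of delta integrals. -/

section Integral

variable {E : Type*} [NormedAddCommGroup E] [NormedSpace ℝ E]

theorem DeltaIntegrable.exists_antideriv {T : Set ℝ} {f : ℝ → E} {a b : ℝ}
    (h : DeltaIntegrable T f a b) :
    ∃ G : ℝ → E, IsDeltaAntideriv T f a b G ∧ deltaIntegral T f a b = G b - G a :=
  ⟨h.choose, h.choose_spec, dif_pos h⟩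

/-- Two delta integrals over intervals that are translates of each other. -/
theorem norm_map_deltaIntegral_sub_le {E' : Type*} [NormedAddCommGroup E'] [NormedSpace ℝ E']
    (l : E →L[ℝ] E') {T : Set ℝ} (hT : IsClosed T) {f g : ℝ → E} {a b β B : ℝ} (hab : a ≤ b)
    (ha : a ∈ T) (hb : b ∈ T) (hTβ : ∀ s, a ≤ s → (s ∈ T ↔ s - β ∈ T))
    (hf : DeltaIntegrable T f a b) (hg : DeltaIntegrable T g (a - β) (b - β))
    (hB : ∀ s ∈ T, a ≤ s → s ≤ b → ‖l (f s - g (s - β))‖ ≤ B) :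
    ‖l (deltaIntegral T f a b - deltaIntegral T g (a - β) (b - β))‖ ≤ B * (b - a) := by
  obtain ⟨G, ⟨hGc, hGd⟩, hG⟩ := hf.exists_antideriv
  obtain ⟨H, ⟨hHc, hHd⟩, hH⟩ := hg.exists_antideriv
  have hab' : a - β ≤ b - β := by linarith
  rw [uIcc_of_le hab] at hGc hGd
  rw [max_eq_right hab] at hGd
  rw [uIcc_of_le hab'] at hHc hHd
  rw [max_eq_right hab'] at hHd
  have hiff : ∀ s, s ∈ T ∩ Icc a b ↔ s - β ∈ T ∩ Icc (a - β) (b - β) := by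
    intro s
    simp only [mem_inter_iff, mem_Icc, sub_le_sub_iff_right]
    constructor
    · rintro ⟨h1, h2, h3⟩; exact ⟨(hTβ s h2).1 h1, h2, h3⟩
    · rintro ⟨h1, h2, h3⟩; exact ⟨(hTβ s h2).2 h1, h2, h3⟩
  -- The mean value inequality is applied to the difference of the antiderivatives, one of them
  -- shifted by `β`; `l` serves to measure it in another norm.
  have hcont : ContinuousOn (fun s => l (G s - H (s - β))) (T ∩ Icc a b) :=
    l.continuous.comp_continuousOn (hGc.sub
      (hHc.comp (by fun_prop) fun s hs => (hiff s).1 hs))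
  have := norm_sub_le_of_hasDeltaDerivAt (hT.inter isClosed_Icc) (a := a) (b := b) (B := B)
    ⟨ha, le_rfl, hab⟩ ⟨hb, hab, le_rfl⟩ hab hcont (f' := fun s => l (f s - g (s - β))) ?_ ?_
  · rw [hG, hH]
    refine le_trans (le_of_eq ?_) this
    rw [← map_sub]
    congr 2
    abel
  · rintro s hs - ⟨r, hr, hsr⟩
    have hsb : s < b := hsr.trans_le hr.2.2
    refine HasDeltaDerivAt.clm_comp (HasDeltaDerivAt.sub (hGd s hs hsb) ?_) l
    exact (hHd (s - β) ((hiff s).1 hs) (by linarith)).comp_sub_const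
      (sigma_eq_sigma_sub_add fun q _ => hiff q) (Eventually.of_forall fun q hq => (hiff q).1 hq)
  · rintro s hs - -
    exact hB s hs.1 hs.2.1 hs.2.2

end Integral

/-! ### Boundedness on compact time scale intervals. -/

section Bounded

variable {E : Type*} [NormedAddCommGroup E]

theorem exists_bound_of_isBoundedUnder {S : Set ℝ} (hS : IsCompact S) {f : ℝ → E}
    (h : ∀ t ∈ S, ∃ B, ∀ᶠ s in 𝓝[S] t, ‖f s‖ ≤ B) : ∃ B, ∀ t ∈ S, ‖f t‖ ≤ B := by
  refine hS.induction_on (p := fun U => ∃ B, ∀ t ∈ U, ‖f t‖ ≤ B) ⟨0, by simp⟩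
    (fun U V hUV ⟨B, hB⟩ => ⟨B, fun t ht => hB t (hUV ht)⟩) ?_ ?_
  · rintro U V ⟨B, hB⟩ ⟨B', hB'⟩
    refine ⟨max B B', fun t ht => ht.elim (fun h => (hB t h).trans (le_max_left _ _))
      fun h => (hB' t h).trans (le_max_right _ _)⟩
  · intro t ht
    obtain ⟨B, hB⟩ := h t ht
    exact ⟨_, hB, B, fun s hs => hs⟩

/-- Local bounds suffice by compactness. At a point that is not right-dense, no other points lie
nearby on the right, so the value there and a bound from the left are enough. -/
theorem RdContinuous.exists_bound {S : Set ℝ} (hS : IsCompact S) {f : ℝ → E}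
    (hf : RdContinuous S f) : ∃ B, ∀ t ∈ S, ‖f t‖ ≤ B := by
  refine exists_bound_of_isBoundedUnder hS fun t ht => ?_
  obtain ⟨hr, hl⟩ := hf t ht
  by_cases hd : RightDense S t
  · refine ⟨‖f t‖ + 1, ?_⟩
    exact ((hr hd).norm.eventually (gt_mem_nhds (lt_add_one _))).mono fun s hs => hs.le
  have hright : ∀ᶠ s in 𝓝 t, s ∈ S → s ≤ t := by
    by_cases hex : ∃ s ∈ S, t < s
    · have hσ : t < sigma S t := lt_of_le_of_ne le_sigma fun h => hd ⟨hex, h.symm⟩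
      filter_upwards [gt_mem_nhds hσ] with s hs hsS
      by_contra hc
      exact absurd (sigma_le hsS (not_le.1 hc)) (not_le.2 hs)
    · push Not at hex
      exact Eventually.of_forall hex
  obtain ⟨B, hB⟩ : ∃ B, ∀ᶠ s in 𝓝[S ∩ Iio t] t, ‖f s‖ ≤ B := by
    by_cases hld : LeftDense S t
    · obtain ⟨l, hl⟩ := hl hld
      exact ⟨‖l‖ + 1, (hl.norm.eventually (gt_mem_nhds (lt_add_one _))).mono fun s hs => hs.le⟩
    · refine ⟨0, ?_⟩
      have : ∀ᶠ s in 𝓝 t, s ∈ S → t ≤ s := by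
        by_cases hex : ∃ s ∈ S, s < t
        · have hlub : IsLUB (S ∩ Iio t) (rho S t) := by
            rw [rho, if_pos hex]
            obtain ⟨r, hr, hrt⟩ := hex
            exact isLUB_csSup ⟨r, hr, hrt⟩ ⟨t, fun _ hx => hx.2.le⟩
          have hρ : rho S t < t :=
            lt_of_le_of_ne (hlub.2 fun _ hx => hx.2.out.le) fun h => hld ⟨hex, h⟩
          filter_upwards [lt_mem_nhds hρ] with s hs hsS
          by_contra hc
          exact absurd (hlub.1 ⟨hsS, not_le.1 hc⟩) (not_le.2 hs)
        · push Not at hex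
          exact Eventually.of_forall hex
      filter_upwards [this.filter_mono nhdsWithin_le_nhds, self_mem_nhdsWithin] with s hs hsS
      exact absurd (hs hsS.1) (not_le.2 hsS.2)
  rw [eventually_nhdsWithin_iff] at hB
  refine ⟨max B ‖f t‖, eventually_nhdsWithin_iff.2 ?_⟩
  filter_upwards [hB, hright] with s hs hs' hsS
  rcases (hs' hsS).eq_or_lt with h | h
  · rw [h]; exact le_max_right _ _
  · exact (hs ⟨hsS, h⟩).trans (le_max_left _ _)

end Bounded

/-! ### The Halanay inequality. -/

section Halanay

variable {E : Type*} [NormedAddCommGroup E] [NormedSpace ℝ E]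

/-- A Halanay inequality on a time scale for the equation `w^Δ = B w + k`, where `k` is bounded in
terms of the values of `w` up to the present. -/
theorem norm_le_mul_exp_of_hasDeltaDerivAt {S : Set ℝ} (hS : IsClosed S) {t₀ : ℝ} (ht₀ : t₀ ∈ S)
    {w k : ℝ → E} {B : E →L[ℝ] E} {m c d ν C : ℝ} (hC : 0 < C)
    (hw : ∀ t ∈ S, t₀ ≤ t → HasDeltaDerivAt S w (B (w t) + k t) t)
    (hscat : ∀ t ∈ S, t₀ ≤ t → 0 < graininess S t →
      ‖(1 : E →L[ℝ] E) + graininess S t • B‖ ≤ 1 + graininess S t * m)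
    (hdense : ∀ t ∈ S, t₀ ≤ t → graininess S t = 0 → ∀ ε > 0,
      ∀ᶠ h in 𝓝[>] (0 : ℝ), ‖(1 : E →L[ℝ] E) + h • B‖ ≤ 1 + h * (m + ε))
    (hk : ∀ t ∈ S, t₀ ≤ t → (∀ s ∈ S, s ≤ t → ‖w s‖ ≤ C * Real.exp (-(ν * s))) →
      ‖k t‖ ≤ c * ‖w t‖ + d * (C * Real.exp (-(ν * t))))
    (hgap : ν + (m + c) + d < 0)
    (hreg : ∀ t ∈ S, t₀ ≤ t → 0 ≤ 1 + graininess S t * (m + c))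
    (hinit : ∀ s ∈ S, s ≤ t₀ → ‖w s‖ ≤ C * Real.exp (-(ν * s))) :
    ∀ t ∈ S, ‖w t‖ ≤ C * Real.exp (-(ν * t)) := by
  -- `1 - hν ≤ exp(-hν)`: it is enough to bring the estimate below the linear decay.
  have hstep : ∀ (t h : ℝ), C * Real.exp (-(ν * t)) * (1 - h * ν)
      ≤ C * Real.exp (-(ν * (t + h))) := by
    intro t h
    have e : Real.exp (-(ν * (t + h))) = Real.exp (-(ν * t)) * Real.exp (-(h * ν)) := by
      rw [← Real.exp_add]; congr 1; ring
    rw [e, ← mul_assoc]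
    have := Real.add_one_le_exp (-(h * ν))
    gcongr
    linarith
  have hnorm : ∀ (t h : ℝ), 0 ≤ h → ‖w t + h • (B (w t) + k t)‖
      ≤ ‖(1 : E →L[ℝ] E) + h • B‖ * ‖w t‖ + h * ‖k t‖ := by
    intro t h hh
    have e : w t + h • (B (w t) + k t) = ((1 : E →L[ℝ] E) + h • B) (w t) + h • k t := by
      simp [smul_add, add_assoc]
    rw [e]
    refine (norm_add_le _ _).trans ?_
    rw [norm_smul, Real.norm_eq_abs, abs_of_nonneg hh]
    gcongr
    exact ContinuousLinearMap.le_opNorm _ _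
  suffices H : ∀ t ∈ S, t₀ ≤ t → ‖w t‖ ≤ C * Real.exp (-(ν * t)) from fun t ht =>
    (le_total t t₀).elim (hinit t ht) (H t ht)
  have hall : ∀ t, (∀ s ∈ S, t₀ ≤ s → s ≤ t → ‖w s‖ ≤ C * Real.exp (-(ν * s))) →
      ∀ s ∈ S, s ≤ t → ‖w s‖ ≤ C * Real.exp (-(ν * s)) := fun t hp s hs hst =>
    (le_total s t₀).elim (hinit s hs) fun h => hp s hs h hst
  refine induction_on hS ht₀ (hinit t₀ ht₀ le_rfl) ?_ ?_ ?_
  · intro t ht htt hσ hp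
    have hμ : 0 < graininess S t := sub_pos.2 hσ
    have h1 := (hw t ht htt).apply_sigma ht
    have h2 := hnorm t _ hμ.le
    have h3 := hscat t ht htt hμ
    have h4 := hk t ht htt (hall t hp)
    have h5 := hreg t ht htt
    have h6 := hp t ht htt le_rfl
    have h7 := hstep t (graininess S t)
    have e : t + graininess S t = sigma S t := by rw [graininess]; ring
    rw [e] at h7
    rw [h1]
    refine (h2.trans ?_).trans h7
    set D := C * Real.exp (-(ν * t)) with hD
    have hD0 : 0 < D := by positivity
    set μ := graininess S t
    calc _ ≤ (1 + μ * m) * ‖w t‖ + μ * (c * ‖w t‖ + d * D) := by gcongr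
      _ = (1 + μ * (m + c)) * ‖w t‖ + μ * d * D := by ring
      -- Regressivity makes this factor nonnegative, so `‖w t‖` may be replaced by its bound `D`.
      _ ≤ (1 + μ * (m + c)) * D + μ * d * D := by gcongr
      _ = D * (1 + μ * (m + c + d)) := by ring
      _ ≤ D * (1 - μ * ν) := by
        gcongr
        nlinarith
  · intro t ht htt hσ hp
    set D := C * Real.exp (-(ν * t)) with hD
    have hD0 : 0 < D := by positivity
    -- The gap is spent in two halves: one on the error of the matrix measure, one on that of the
    -- derivative.
    set γ := -(ν + (m + c) + d) with hγ
    have hγ0 : 0 < γ := by linarith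
    have hμ : graininess S t = 0 := by rw [graininess, hσ.2, sub_self]
    have hsub : Tendsto (fun s => s - t) (𝓝[S ∩ Ioi t] t) (𝓝[>] 0) := by
      refine tendsto_nhdsWithin_iff.2 ⟨?_, ?_⟩
      · have : Tendsto (fun s => s - t) (𝓝 t) (𝓝 (t - t)) :=
          Continuous.tendsto (by fun_prop) t
        rw [sub_self] at this
        exact this.mono_left nhdsWithin_le_nhds
      · filter_upwards [self_mem_nhdsWithin] with s hs
        exact sub_pos.2 hs.2.out
    have hpos : ∀ᶠ h in 𝓝[>] (0 : ℝ), 0 < 1 + h * (m + c + γ / 2) := by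
      have : Tendsto (fun h => 1 + h * (m + c + γ / 2)) (𝓝 0) (𝓝 (1 + 0 * (m + c + γ / 2))) :=
        Continuous.tendsto (by fun_prop) 0
      exact (this.eventually (lt_mem_nhds (by norm_num))).filter_mono nhdsWithin_le_nhds
    have h4 := hk t ht htt (hall t hp)
    have h6 := hp t ht htt le_rfl
    filter_upwards [(hw t ht htt).eventually_norm_sub_le hσ.2 (ε := γ / 2 * D) (by positivity),
      hsub.eventually (hdense t ht htt hμ (γ / 2) (by positivity)), hsub.eventually hpos,
      hsub.eventually self_mem_nhdsWithin] with s hs1 hs2 hs3 hs4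
    have h7 := hstep t (s - t)
    rw [add_sub_cancel] at h7
    refine le_trans ?_ h7
    rw [← hD]
    set h := s - t
    have hh : 0 < h := hs4
    have h2 := hnorm t h hh.le
    have h8 : ‖w s‖ ≤ ‖w t + h • (B (w t) + k t)‖ + γ / 2 * D * h := by
      have := norm_add_le (w s - (w t + h • (B (w t) + k t))) (w t + h • (B (w t) + k t))
      rw [sub_add_cancel] at this
      linarith
    calc _ ≤ _ := h8
      _ ≤ (1 + h * (m + γ / 2)) * ‖w t‖ + h * (c * ‖w t‖ + d * D) + γ / 2 * D * h := by
        gcongr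
        refine h2.trans ?_
        gcongr
      _ = (1 + h * (m + c + γ / 2)) * ‖w t‖ + h * d * D + γ / 2 * D * h := by ring
      _ ≤ (1 + h * (m + c + γ / 2)) * D + h * d * D + γ / 2 * D * h := by gcongr
      _ = D * (1 - h * ν) := by rw [hγ]; ring
  · intro t ht htt hcl hp
    have hne : (𝓝[S ∩ Ico t₀ t] t).NeBot := mem_closure_iff_nhdsWithin_neBot.1 hcl
    refine le_of_tendsto_of_tendsto (b := 𝓝[S ∩ Ico t₀ t] t) (f := fun t => ‖w t‖)
      (g := fun t => C * Real.exp (-(ν * t)))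
      (((hw t ht htt.le).continuousWithinAt ht).norm.mono_left
        (nhdsWithin_mono _ inter_subset_left))
      ((Continuous.tendsto (by fun_prop) t).mono_left nhdsWithin_le_nhds) ?_
    filter_upwards [self_mem_nhdsWithin] with s hs
    exact hp s hs.1 hs.2.1 hs.2.2

end Halanay

end TimeScale

namespace LagSync

open TimeScale

/-! ### Operator norms and matrix measures. -/

section Matrix

variable {n : ℕ} {p : ℝ≥0∞} [Fact (1 ≤ p)]

/-- The operator of a matrix on `ℝⁿ` with the `p`-norm. -/
noncomputable def toOp (p : ℝ≥0∞) [Fact (1 ≤ p)] (W : Matrix (Fin n) (Fin n) ℝ) :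
    PiLp p (fun _ : Fin n => ℝ) →L[ℝ] PiLp p (fun _ : Fin n => ℝ) :=
  (Matrix.toLpLin p p W).toContinuousLinearMap

theorem toOp_toLp (W : Matrix (Fin n) (Fin n) ℝ) (v : Fin n → ℝ) :
    toOp p W (WithLp.toLp p v) = WithLp.toLp p (W *ᵥ v) := rfl

theorem norm_toOp (W : Matrix (Fin n) (Fin n) ℝ) : ‖toOp p W‖ = matNorm p W := rfl

theorem toOp_one_add_smul (W : Matrix (Fin n) (Fin n) ℝ) (h : ℝ) :
    toOp p (1 + h • W) = 1 + h • toOp p W := by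
  ext v : 1
  simp [toOp]

theorem vecNorm_mulVec_le (W : Matrix (Fin n) (Fin n) ℝ) (v : Fin n → ℝ) :
    vecNorm p (W *ᵥ v) ≤ matNorm p W * vecNorm p v :=
  (toOp p W).le_opNorm (WithLp.toLp p v)

theorem matNorm_nonneg (W : Matrix (Fin n) (Fin n) ℝ) : 0 ≤ matNorm p W := norm_nonneg _

theorem vecNorm_nonneg (v : Fin n → ℝ) : 0 ≤ vecNorm p v := norm_nonneg _

theorem vecNorm_add_le (v w : Fin n → ℝ) : vecNorm p (v + w) ≤ vecNorm p v + vecNorm p w :=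
  norm_add_le (WithLp.toLp p v) (WithLp.toLp p w)

theorem vecNorm_le_matNorm_inv_mul {Z : Matrix (Fin n) (Fin n) ℝ} (hZ : IsUnit Z)
    (v : Fin n → ℝ) : vecNorm p v ≤ matNorm p Z⁻¹ * vecNorm p (Z *ᵥ v) := by
  have := vecNorm_mulVec_le (p := p) Z⁻¹ (Z *ᵥ v)
  rwa [Matrix.mulVec_mulVec, Matrix.nonsing_inv_mul _ ((Matrix.isUnit_iff_isUnit_det _).1 hZ),
    Matrix.one_mulVec] at this

variable (W : Matrix (Fin n) (Fin n) ℝ)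

theorem genMatrixMeasure_eq (h : ℝ) :
    genMatrixMeasure p W h = (‖1 + h • toOp p W‖ - 1) / h := by
  rw [genMatrixMeasure, ← norm_toOp, toOp_one_add_smul]

variable [NeZero n]

theorem norm_one_op : ‖(1 : PiLp p (fun _ : Fin n => ℝ) →L[ℝ] PiLp p (fun _ : Fin n => ℝ))‖ = 1 := by
  have : Nontrivial (PiLp p (fun _ : Fin n => ℝ)) := (WithLp.equiv p (Fin n → ℝ)).nontrivial
  exact norm_one

theorem abs_genMatrixMeasure_le {h : ℝ} (hh : 0 < h) : |genMatrixMeasure p W h| ≤ matNorm p W := by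
  rw [genMatrixMeasure_eq, abs_div, abs_of_pos hh, div_le_iff₀ hh]
  have := abs_norm_sub_norm_le (1 + h • toOp p W) 1
  rwa [add_sub_cancel_left, norm_one_op, norm_smul, Real.norm_eq_abs, abs_of_pos hh, norm_toOp,
    mul_comm] at this

/-- Convexity of the norm: `k(1 + hW) = h(1 + kW) + (k - h)1`. -/
theorem monotoneOn_genMatrixMeasure : MonotoneOn (genMatrixMeasure p W) (Ioi 0) := by
  intro h hh k hk hhk
  rw [mem_Ioi] at hh hk
  rw [genMatrixMeasure_eq, genMatrixMeasure_eq, div_le_div_iff₀ hh hk]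
  have e : k • (1 + h • toOp p W) = h • (1 + k • toOp p W) + (k - h) • 1 := by module
  have := norm_add_le (h • (1 + k • toOp p W)) ((k - h) •
    (1 : PiLp p (fun _ : Fin n => ℝ) →L[ℝ] PiLp p (fun _ : Fin n => ℝ)))
  rw [← e, norm_smul, norm_smul, norm_smul, norm_one_op, Real.norm_eq_abs, Real.norm_eq_abs,
    Real.norm_eq_abs, abs_of_pos hh, abs_of_pos hk, abs_of_nonneg (sub_nonneg.2 hhk)] at this
  linarith

/-- The quotient is monotone and bounded below by `-‖W‖`, so the limit exists and `limUnder` is not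
a junk value. -/
theorem tendsto_genMatrixMeasure :
    Tendsto (genMatrixMeasure p W) (𝓝[>] 0) (𝓝 (classicalMatrixMeasure p W)) := by
  refine tendsto_nhds_limUnder ⟨_, (monotoneOn_genMatrixMeasure W).tendsto_nhdsGT ?_⟩
  refine ⟨-matNorm p W, ?_⟩
  rintro _ ⟨h, hh, rfl⟩
  exact (abs_le.1 (abs_genMatrixMeasure_le W hh)).1

theorem norm_one_add_smul_le_of_graininess_pos {T : Set ℝ} {t : ℝ} (ht : t ∈ T)
    (hμ : 0 < graininess T t) :
    ‖1 + graininess T t • toOp p W‖ ≤ 1 + graininess T t * unifiedMatrixMeasure p W T := by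
  have key : genMatrixMeasure p W (graininess T t) ≤ unifiedMatrixMeasure p W T := by
    unfold unifiedMatrixMeasure
    split_ifs with h
    · refine le_csSup ⟨matNorm p W, ?_⟩ ⟨t, ht, rfl⟩
      rintro _ ⟨s, hs, rfl⟩
      exact (abs_le.1 (abs_genMatrixMeasure_le W (h s hs))).2
    · refine le_csSup (BddAbove.insert _ ⟨matNorm p W, ?_⟩) (Or.inr ⟨t, ht, hμ, rfl⟩)
      rintro _ ⟨s, hs, hs', rfl⟩
      exact (abs_le.1 (abs_genMatrixMeasure_le W hs')).2
  rw [genMatrixMeasure_eq, div_le_iff₀ hμ] at key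
  linarith

theorem eventually_norm_one_add_smul_le {T : Set ℝ} {t : ℝ} (ht : t ∈ T)
    (hμ : graininess T t = 0) {ε : ℝ} (hε : 0 < ε) :
    ∀ᶠ h in 𝓝[>] (0 : ℝ), ‖1 + h • toOp p W‖ ≤ 1 + h * (unifiedMatrixMeasure p W T + ε) := by
  have key : classicalMatrixMeasure p W ≤ unifiedMatrixMeasure p W T := by
    unfold unifiedMatrixMeasure
    rw [if_neg fun h => (h t ht).ne' hμ]
    refine le_csSup (BddAbove.insert _ ⟨matNorm p W, ?_⟩) (Or.inl rfl)
    rintro _ ⟨s, hs, hs', rfl⟩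
    exact (abs_le.1 (abs_genMatrixMeasure_le W hs')).2
  filter_upwards [(tendsto_genMatrixMeasure (p := p) W).eventually
    (gt_mem_nhds (show _ < unifiedMatrixMeasure p W T + ε by linarith)), self_mem_nhdsWithin]
    with h hh hpos
  rw [genMatrixMeasure_eq, div_lt_iff₀ hpos] at hh
  linarith

end Matrix

/-! ### The error equation and its input. -/

namespace Network

variable {n : ℕ} {N : Network n} {T : Set ℝ} {K : Matrix (Fin n) (Fin n) ℝ} {β : ℝ}
  {φ ψ x y u : ℝ → Fin n → ℝ}

theorem IsSolution.continuousOn (h : N.IsSolution T u φ x) : ContinuousOn x (T ∩ Ici 0) :=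
  fun t ht => (h.2 t ht.1 ht.2).2.continuousWithinAt ht

theorem IsSolution.exists_bound (hT : IsClosed T) (h : N.IsSolution T u φ x) (b : ℝ) :
    ∃ B, ∀ t ∈ T, 0 ≤ t → t ≤ b → ‖x t‖ ≤ B := by
  have hc : IsCompact (T ∩ Icc 0 b) := isCompact_Icc.inter_left hT
  obtain ⟨B, hB⟩ := hc.exists_bound_of_continuousOn (h.continuousOn.mono fun t ht => ⟨ht.1, ht.2.1⟩)
  exact ⟨B, fun t ht h0 hb => hB t ⟨ht, h0, hb⟩⟩

theorem IsDriveSolution.exists_bound (hT : IsClosed T)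
    (hφ : RdContinuous (T ∩ Icc (-N.τ) 0) φ) (h : N.IsDriveSolution T β φ x) (b : ℝ) :
    ∃ B, ∀ t ∈ T, -N.τ - β ≤ t → t ≤ b → ‖x t‖ ≤ B := by
  obtain ⟨B, hB⟩ := h.1.exists_bound hT b
  obtain ⟨B', hB'⟩ := hφ.exists_bound (isCompact_Icc.inter_left hT)
  refine ⟨max B (max B' ‖φ (-N.τ)‖), fun t ht htl htb => ?_⟩
  rcases le_total 0 t with h0 | h0
  · exact (hB t ht h0 htb).trans (le_max_left _ _)
  refine le_trans ?_ (le_max_right _ _)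
  rcases le_total (-N.τ) t with hτ | hτ
  · rw [h.1.1 t ht hτ h0]
    exact (hB' t ⟨ht, hτ, h0⟩).trans (le_max_left _ _)
  · rw [h.2 t ht htl hτ]
    exact le_max_right _ _

theorem exists_bound_sub (hT : IsClosed T) (hτ : 0 ≤ N.τ)
    (hTβ : ∀ t ∈ T, 0 ≤ t → t - β ∈ T) (hφ : RdContinuous (T ∩ Icc (-N.τ) 0) φ)
    (hx : N.IsDriveSolution T β φ x) (hy : N.IsSolution T u ψ y) (b : ℝ) :
    ∃ B, ∀ t ∈ T, 0 ≤ t → t ≤ b → ‖y t - x (t - β)‖ ≤ B := by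
  obtain ⟨B, hB⟩ := hx.exists_bound hT hφ (b - β)
  obtain ⟨B', hB'⟩ := hy.exists_bound hT b
  exact ⟨B' + B, fun t ht h0 htb => (norm_sub_le _ _).trans (add_le_add (hB' t ht h0 htb)
    (hB _ (hTβ t ht h0) (by linarith) (by linarith)))⟩

/-- The input of the error equation. -/
noncomputable def errorInput (N : Network n) (T : Set ℝ) (β : ℝ) (x y : ℝ → Fin n → ℝ)
    (t : ℝ) : Fin n → ℝ :=
  N.P *ᵥ (N.F (y t) - N.F (x (t - β))) + N.Q *ᵥ (N.F (y (t - N.τ₁)) - N.F (x (t - N.τ₁ - β)))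
    + N.R *ᵥ (deltaIntegral T (fun s => N.F (y s)) (t - N.τ₂) t
      - deltaIntegral T (fun s => N.F (x s)) (t - N.τ₂ - β) (t - β))

/-- The strict inequality `β < t` keeps `s - β` nonnegative for `s` near `t`, within the range of
the drive equation. The control merges with `-A` and the external input `I` cancels. -/
theorem hasDeltaDerivAt_error (hβ : 0 ≤ β)
    (hTβ : ∀ t ∈ T, 0 ≤ t → t - β ∈ T) (hTβ' : ∀ t ∈ T, 0 ≤ t → t + β ∈ T)
    (hx : N.IsDriveSolution T β φ x) (hy : N.IsResponseSolution T K β x ψ y) {t : ℝ} (ht : t ∈ T)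
    (hβt : β < t) :
    HasDeltaDerivAt (T ∩ Ici 0) (fun s => y s - x (s - β))
      (-((N.A + K) *ᵥ (y t - x (t - β))) + N.errorInput T β x y t) t := by
  have h0 : 0 ≤ t := hβ.trans hβt.le
  have hiff : ∀ s, β ≤ s → (s ∈ T ∩ Ici 0 ↔ s - β ∈ T ∩ Ici 0) := by
    intro s hs
    simp only [mem_inter_iff, mem_Ici, sub_nonneg]
    refine ⟨fun h => ⟨hTβ s h.1 h.2, hs⟩, fun h => ⟨?_, hβ.trans hs⟩⟩
    simpa using hTβ' _ h.1 (sub_nonneg.2 hs)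
  have h1 := (hy.2 t ht h0).2
  have h2 := (hx.1.2 (t - β) (hTβ t ht h0) (sub_nonneg.2 hβt.le)).2
  have h3 := h2.comp_sub_const (S := T ∩ Ici 0)
    (sigma_eq_sigma_sub_add fun s hs => hiff s (hβt.le.trans hs.le))
    ((lt_mem_nhds hβt).mono fun s hs => (hiff s (le_of_lt hs)).1)
  have h4 := h1.sub h3
  refine (congrArg (fun v => HasDeltaDerivAt (T ∩ Ici 0) (fun s => y s - x (s - β)) v t) ?_).mp h4
  simp only [rhs, errorInput, Matrix.mulVec_sub, Matrix.add_mulVec, sub_right_comm t β]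
  abel

theorem vecNorm_errorInput_le {p : ℝ≥0∞} [Fact (1 ≤ p)] {L : ℝ} (hL : 0 ≤ L)
    (hF : ∀ v w : Fin n → ℝ, vecNorm p (N.F v - N.F w) ≤ L * vecNorm p (v - w))
    {Z : Matrix (Fin n) (Fin n) ℝ} (hZ : IsUnit Z) (hT : IsClosed T) (hβ : 0 ≤ β)
    (hτ₁ : 0 ≤ N.τ₁) (hτ₂ : 0 ≤ N.τ₂)
    (hTτ₁ : ∀ t ∈ T, 0 ≤ t → t - N.τ₁ ∈ T) (hTτ₂ : ∀ t ∈ T, 0 ≤ t → t - N.τ₂ ∈ T)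
    (hTβ : ∀ t ∈ T, 0 ≤ t → t - β ∈ T) (hTβ' : ∀ t ∈ T, 0 ≤ t → t + β ∈ T)
    (hx : N.IsDriveSolution T β φ x) (hy : N.IsSolution T u ψ y) {t C ν : ℝ} (hν : 0 ≤ ν)
    (hC : 0 ≤ C) (ht : t ∈ T) (hβt : β + N.τ ≤ t)
    (hist : ∀ s ∈ T, 0 ≤ s → s ≤ t →
      vecNorm p (Z *ᵥ (y s - x (s - β))) ≤ C * Real.exp (-(ν * s))) :
    vecNorm p (Z *ᵥ N.errorInput T β x y t)
      ≤ matNorm p Z * matNorm p Z⁻¹ * matNorm p N.P * L * vecNorm p (Z *ᵥ (y t - x (t - β)))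
        + N.M₄ p Z L * Real.exp (ν * N.τ) * (C * Real.exp (-(ν * t))) := by
  have hτ1 : N.τ₁ ≤ N.τ := le_max_left _ _
  have hτ2 : N.τ₂ ≤ N.τ := le_max_right _ _
  have h0 : 0 ≤ t := by linarith
  set E := Real.exp (ν * N.τ) * (C * Real.exp (-(ν * t))) with hE
  have hE0 : 0 ≤ E := by positivity
  have hZi := matNorm_nonneg (p := p) Z⁻¹
  have hlip : ∀ s, vecNorm p (N.F (y s) - N.F (x (s - β)))
      ≤ L * (matNorm p Z⁻¹ * vecNorm p (Z *ᵥ (y s - x (s - β)))) := fun s =>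
    (hF _ _).trans (mul_le_mul_of_nonneg_left (vecNorm_le_matNorm_inv_mul hZ _) hL)
  have hdelay : ∀ s ∈ T, t - N.τ ≤ s → s ≤ t →
      vecNorm p (N.F (y s) - N.F (x (s - β))) ≤ L * (matNorm p Z⁻¹ * E) := by
    intro s hs hts hst
    refine (hlip s).trans ?_
    gcongr
    refine (hist s hs (by linarith) hst).trans ?_
    -- `s ≥ t - τ` costs the factor `exp(ντ)`.
    rw [hE, mul_left_comm, ← Real.exp_add]
    gcongr
    nlinarith
  have hQ := hdelay (t - N.τ₁) (hTτ₁ t ht h0) (by linarith) (by linarith)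
  have hR : vecNorm p (deltaIntegral T (fun s => N.F (y s)) (t - N.τ₂) t
      - deltaIntegral T (fun s => N.F (x s)) (t - N.τ₂ - β) (t - β))
      ≤ L * (matNorm p Z⁻¹ * E) * N.τ := by
    have h1 := (hy.2 t ht h0).1
    have h2 := (hx.1.2 (t - β) (hTβ t ht h0) (by linarith)).1
    rw [sub_right_comm] at h2
    have := norm_map_deltaIntegral_sub_le (B := L * (matNorm p Z⁻¹ * E))
      ((PiLp.continuousLinearEquiv p ℝ (fun _ : Fin n => ℝ)).symm :
        (Fin n → ℝ) →L[ℝ] PiLp p (fun _ : Fin n => ℝ)) hT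
      (by linarith) (hTτ₂ t ht h0) ht (fun s hs => ?_) h1 h2 ?_
    · refine (this : vecNorm p _ ≤ _).trans ?_
      rw [sub_sub_cancel]
      gcongr
    · refine ⟨fun h => hTβ s h (by linarith), fun h => ?_⟩
      simpa using hTβ' _ h (by linarith)
    · intro s hs hts hst
      exact hdelay s hs (by linarith) hst
  have hτ0 : 0 ≤ N.τ := hτ₁.trans hτ1
  refine (vecNorm_mulVec_le Z _).trans ?_
  have hsum : vecNorm p (N.errorInput T β x y t)
      ≤ matNorm p N.P * (L * (matNorm p Z⁻¹ * vecNorm p (Z *ᵥ (y t - x (t - β)))))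
        + matNorm p N.Q * (L * (matNorm p Z⁻¹ * E))
        + matNorm p N.R * (L * (matNorm p Z⁻¹ * E) * N.τ) := by
    refine (vecNorm_add_le _ _).trans (add_le_add ((vecNorm_add_le _ _).trans (add_le_add ?_ ?_)) ?_)
    · exact (vecNorm_mulVec_le _ _).trans
        (mul_le_mul_of_nonneg_left (hlip t) (matNorm_nonneg _))
    · exact (vecNorm_mulVec_le _ _).trans (mul_le_mul_of_nonneg_left hQ (matNorm_nonneg _))
    · exact (vecNorm_mulVec_le _ _).trans (mul_le_mul_of_nonneg_left hR (matNorm_nonneg _))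
  refine (mul_le_mul_of_nonneg_left hsum (matNorm_nonneg _)).trans_eq ?_
  rw [M₄, hE]
  ring

/-- Continuity in `ν`, since the strict inequality holds at `ν = 0`. -/
theorem exists_rate {M M' τ : ℝ} (h : M' < M) :
    ∃ ν : ℝ, 0 < ν ∧ ν + M' * Real.exp (ν * τ) < M := by
  have h1 : Tendsto (fun ν => ν + M' * Real.exp (ν * τ)) (𝓝 0)
      (𝓝 (0 + M' * Real.exp (0 * τ))) := Continuous.tendsto (by fun_prop) 0
  have h2 := (h1.eventually (gt_mem_nhds (show _ < M by simpa using h))).filter_mono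
    (nhdsWithin_le_nhds (s := Ioi 0))
  obtain ⟨ν, hν, hν0⟩ := (h2.and self_mem_nhdsWithin).exists
  exact ⟨ν, hν0, hν⟩

end Network

end LagSync

/-! ### Exponential lag synchronization. -/

theorem mainTheorem2 {n : ℕ} (p : ℝ≥0∞) [Fact (1 ≤ p)] (hp : p = 1 ∨ p = 2 ∨ p = ⊤)
    (T : Set ℝ) (hT : IsClosed T) (hT0 : (0 : ℝ) ∈ T)
    (N : LagSync.Network n) (ha : ∀ i, 0 < N.a i)
    (hτ₁ : 0 < N.τ₁) (hτ₂ : 0 < N.τ₂)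
    (hTτ₁ : ∀ t ∈ T, 0 ≤ t → t - N.τ₁ ∈ T) (hTτ₂ : ∀ t ∈ T, 0 ≤ t → t - N.τ₂ ∈ T)
    (β : ℝ) (hβ : 0 ≤ β)
    (hTβ : ∀ t ∈ T, 0 ≤ t → t - β ∈ T) (hTβ' : ∀ t ∈ T, 0 ≤ t → t + β ∈ T)
    (L : ℝ) (hL : 0 < L)
    (hF : ∀ v w : Fin n → ℝ,
      LagSync.vecNorm p (N.F v - N.F w) ≤ L * LagSync.vecNorm p (v - w))
    (K Z : Matrix (Fin n) (Fin n) ℝ) (hZ : IsUnit Z)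
    (hM : 0 < N.M₃ p T K Z L - N.M₄ p Z L)
    (hreg : TimeScale.PositivelyRegressive T (fun _ => -(N.M₃ p T K Z L))) :
    N.ExpLagSynchronized p T K β := by
  open TimeScale LagSync LagSync.Network in
  have hτ : 0 < N.τ := hτ₁.trans_le (le_max_left _ _)
  obtain ⟨ν, hν, hνM⟩ := exists_rate (τ := N.τ) (sub_pos.1 hM)
  refine ⟨ν, hν, fun φ ψ x y hφ _ hx hy => ?_⟩
  suffices H : ∃ C, 0 < C ∧ ∀ t ∈ T, 0 ≤ t →
      vecNorm p (Z *ᵥ (y t - x (t - β))) ≤ C * Real.exp (-(ν * t)) by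
    obtain ⟨C, hC, H⟩ := H
    have hZi := matNorm_nonneg (p := p) Z⁻¹
    refine ⟨(matNorm p Z⁻¹ + 1) * C, by positivity, fun t ht h0 => ?_⟩
    have h1 := exp_neg_mul_le_expTS hT hν.le hT0 ht h0
    rw [sub_zero] at h1
    calc _ ≤ matNorm p Z⁻¹ * vecNorm p (Z *ᵥ (y t - x (t - β))) :=
          vecNorm_le_matNorm_inv_mul hZ _
      _ ≤ (matNorm p Z⁻¹ + 1) * (C * Real.exp (-(ν * t))) := by
          refine mul_le_mul (by linarith) (H t ht h0) (vecNorm_nonneg _) (by linarith)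
      _ ≤ _ := by rw [mul_assoc]; gcongr
  set l : (Fin n → ℝ) →L[ℝ] PiLp p (fun _ : Fin n => ℝ) := (toOp p Z).comp
    ((PiLp.continuousLinearEquiv p ℝ (fun _ : Fin n => ℝ)).symm :
        (Fin n → ℝ) →L[ℝ] PiLp p (fun _ : Fin n => ℝ)) with hl
  have hlv : ∀ v, l v = WithLp.toLp p (Z *ᵥ v) := fun v => rfl
  have hbound : ∀ b, ∃ C, 0 < C ∧ ∀ t ∈ T, 0 ≤ t → t ≤ b →
      vecNorm p (Z *ᵥ (y t - x (t - β))) ≤ C * Real.exp (-(ν * t)) := by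
    intro b
    obtain ⟨B, hB⟩ := exists_bound_sub hT hτ.le hTβ hφ hx hy b
    -- `exp(νb)` offsets the decay up to time `b`; the `+ 1` makes the constant positive.
    refine ⟨(‖l‖ * |B| + 1) * Real.exp (ν * b), by positivity, fun t ht h0 htb => ?_⟩
    have h1 : vecNorm p (Z *ᵥ (y t - x (t - β))) ≤ ‖l‖ * |B| :=
      l.le_opNorm_of_le ((hB t ht h0 htb).trans (le_abs_self B))
    have h2 : 1 ≤ Real.exp (ν * b) * Real.exp (-(ν * t)) := by
      rw [← Real.exp_add]
      exact Real.one_le_exp (by nlinarith)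
    rw [mul_assoc]
    nlinarith [norm_nonneg l, abs_nonneg B, mul_nonneg (norm_nonneg l) (abs_nonneg B)]
  -- `T` may be bounded above; if it ends before `β + τ`, boundedness alone is enough.
  by_cases hex : ∃ t₀ ∈ T, β + N.τ ≤ t₀
  swap
  · push Not at hex
    obtain ⟨C, hC, H⟩ := hbound (β + N.τ)
    exact ⟨C, hC, fun t ht h0 => H t ht h0 (hex t ht).le⟩
  obtain ⟨t₀, ht₀, hβt₀⟩ := hex
  obtain ⟨C, hC, hinit⟩ := hbound t₀
  refine ⟨C, hC, ?_⟩
  -- In dimension `0` the identity has norm `0`, so the matrix measure lemmas do not apply; the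
  -- error is then zero.
  rcases Nat.eq_zero_or_pos n with rfl | hn
  · intro t _ _
    have : vecNorm p (Z *ᵥ (y t - x (t - β))) = 0 := by
      rw [Subsingleton.elim (Z *ᵥ (y t - x (t - β))) 0]
      exact norm_zero (E := PiLp p (fun _ : Fin 0 => ℝ))
    rw [this]
    positivity
  have : NeZero n := ⟨hn.ne'⟩
  have hdet := (Matrix.isUnit_iff_isUnit_det _).1 hZ
  have hgr : ∀ t, 0 ≤ t → graininess (T ∩ Ici 0) t = graininess T t := by
    intro t h0
    rw [graininess, graininess, sigma_congr (S := T ∩ Ici 0) (S' := T)]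
    exact fun s hs => ⟨fun h => h.1, fun h => ⟨h, h0.trans hs.le⟩⟩
  set m := unifiedMatrixMeasure p (-(Z * (N.A + K) * Z⁻¹)) T with hm
  set c := matNorm p Z * matNorm p Z⁻¹ * matNorm p N.P * L with hc
  have hM₃ : N.M₃ p T K Z L = -(m + c) := rfl
  have h0t : ∀ {t}, t₀ ≤ t → β < t := fun {t} h => by linarith
  have main := norm_le_mul_exp_of_hasDeltaDerivAt (hT.inter isClosed_Ici) (t₀ := t₀)
    (S := T ∩ Ici 0) ⟨ht₀, by rw [mem_Ici]; linarith⟩ (w := fun t => l (y t - x (t - β)))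
    (k := fun t => l (N.errorInput T β x y t)) (B := toOp p (-(Z * (N.A + K) * Z⁻¹)))
    (m := m) (c := c) (d := N.M₄ p Z L * Real.exp (ν * N.τ)) (ν := ν) hC ?_ ?_ ?_ ?_ ?_ ?_ ?_
  · exact fun t ht h0 => main t ⟨ht, h0⟩
  · intro t ht htt
    have h1 := (hasDeltaDerivAt_error hβ hTβ hTβ' hx hy ht.1 (h0t htt)).clm_comp l
    refine (congrArg (fun v => HasDeltaDerivAt (T ∩ Ici 0) (fun s => l (y s - x (s - β))) v t)
      ?_).mp h1
    rw [map_add]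
    congr 1
    -- Conjugation: `Z(A+K) = (Z(A+K)Z⁻¹)Z`.
    rw [hlv, hlv, toOp_toLp, Matrix.mulVec_mulVec, Matrix.neg_mul, Matrix.mul_assoc _ _ Z,
      Matrix.nonsing_inv_mul _ hdet, Matrix.mul_one, Matrix.neg_mulVec, Matrix.mulVec_neg,
      Matrix.mulVec_mulVec]
  · intro t ht _ hμ
    rw [hgr t ht.2] at hμ ⊢
    exact norm_one_add_smul_le_of_graininess_pos _ ht.1 hμ
  · intro t ht _ hμ ε hε
    rw [hgr t ht.2] at hμ
    exact eventually_norm_one_add_smul_le _ ht.1 hμ hε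
  · intro t ht htt hist
    exact vecNorm_errorInput_le hL.le hF hZ hT hβ hτ₁.le hτ₂.le hTτ₁ hTτ₂ hTβ hTβ' hx hy hν.le hC.le
      ht.1 (hβt₀.trans htt) fun s hs h0 hst => hist s ⟨hs, h0⟩ hst
  · linarith
  · intro t ht _
    rw [hgr t ht.2]
    have := hreg.2 t ht.1
    rw [hM₃, neg_neg] at this
    exact this.le
  · exact fun s hs hst => hinit s hs.1 hs.2 hst
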